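/- Let $n\ge 2$, let $M_n=F_n/F_n''$ be the free metabelian group on $a_1,\dots,a_n$, and let $g\mapsto\bar g$ be the canonical epimorphism $M_n\to A_n=M_n/M_n'\cong\mathbb Z^n$ (written additively). Let $\Gamma_n$ be the Cayley graph of $A_n$ with respect to $\bar a_1,\dots,\bar a_n$. For $h\in M_n$ let $\sigma(h)\in C_1(\Gamma_n)$ be the integral 1-chain that is the sum of the edges traversed by the path in $\Gamma_n$ which starts at $0$ and is labelled by a word representing $h$. For a subgroup $L\le A_n$ let $\tau_L(h)$ be the image of $\sigma(h)$ in $C_1(\Gamma_n/L)$; the group $A_n$ acts on $C_1(\Gamma_n/L)$ by translations. Let $\phi:M_n'\to\Lambda^2(A_n)$ be the homomorphism with $\phi([h,k])=\bar h\wedge\bar k$ for all $h,k\in M_n$. Let $g,m\ge 0$ and $c_1,\dots,c_m\in M_n$, and consider the equation in $M_n$ $$[x_1,y_1]\cdots[x_g,y_g]=z_1c_1z_1^{-1}\cdots z_mc_mz_m^{-1}.\qquad(*)$$ Let $(\bar u_1,\bar v_1,\dots,\bar u_g,\bar v_g,\bar w_1,\dots,\bar w_m)$ be a tuple of elements of $A_n$,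 and let $L$ be the subgroup of $A_n$ generated by all $\bar u_i$, $\bar v_i$ and $\bar c_i$. Then the tuple can be lifted to a solution $(u_1,v_1,\dots,u_g,v_g,w_1,\dots,w_m)$ of $(*)$ in $M_n$ if and only if the following two conditions hold: $$\text{(1)}\quad \sum_{i=1}^m\bar w_i\,\tau_L(c_i)=0\ \text{ in } C_1(\Gamma_n/L),$$ $$\text{(2)}\quad c_1\cdots c_m\in M_n'\ \text{ and }\ \sum_{i=1}^g\bar u_i\wedge\bar v_i=\sum_{i=1}^m\bar w_i\wedge\bar c_i+\phi(c_1c_2\cdots c_m)\ \text{ in }\Lambda^2(A_n).$$ Moreover, (1) by itself implies $c_1\cdots c_m\in M_n'$, so that $\phi(c_1\cdots c_m)$ in (2) is defined whenever (1) holds. -/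

import Mathlib

/-- The free metabelian group `M_n = F_n / F_n''` of rank `n`. -/
abbrev FreeMetabelian (n : ℕ) : Type :=
  FreeGroup (Fin n) ⧸ derivedSeries (FreeGroup (Fin n)) 2

namespace FreeMetabelian

/-- The free abelian group `A_n = ℤⁿ`, identified with `M_n / M_n'` through `bar` below
(see `bar_surjective` and `bar_eq_zero_iff`). -/
abbrev A (n : ℕ) : Type := Fin n → ℤ

/-- The free generator `a_i` of `M_n`. -/
def gen {n : ℕ} (i : Fin n) : FreeMetabelian n :=
  QuotientGroup.mk (FreeGroup.of i)

/-- The basis element `ā_i` of `A_n`. -/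
def e {n : ℕ} (i : Fin n) : A n := Pi.single i 1

theorem derivedSeries_two_le_ker {F G B : Type*} [Group F] [Group G] [CommGroup B]
    (f : F →* G) (p : G →* B) (h : ∀ x y : G, p x = 1 → p y = 1 → x * y = y * x) :
    derivedSeries F 2 ≤ f.ker := by
  have h1 : derivedSeries F 1 ≤ (p.comp f).ker := by
    rw [derivedSeries_one]
    exact Abelianization.commutator_subset_ker _
  rw [derivedSeries_succ, Subgroup.commutator_le]
  intro x hx y hy
  rw [MonoidHom.mem_ker, map_commutatorElement, commutatorElement_eq_one_iff_mul_comm]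
  exact h _ _ (h1 hx) (h1 hy)

/-- The canonical epimorphism `M_n → A_n`, `a_i ↦ ā_i`, as a homomorphism to the
multiplicative copy of `A_n`. -/
def barHom (n : ℕ) : FreeMetabelian n →* Multiplicative (A n) :=
  QuotientGroup.lift _ (FreeGroup.lift fun i => Multiplicative.ofAdd (e i))
    (derivedSeries_two_le_ker _ (MonoidHom.id _) fun x y _ _ => mul_comm x y)

/-- The canonical epimorphism `g ↦ ḡ` from `M_n` to `A_n` (written additively). -/
def bar {n : ℕ} (g : FreeMetabelian n) : A n := (barHom n g).toAdd

@[simp] theorem bar_gen {n : ℕ} (i : Fin n) : bar (gen i) = e i := by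
  show (FreeGroup.lift (fun i => Multiplicative.ofAdd (e i)) (FreeGroup.of i)).toAdd = e i
  rw [FreeGroup.lift_apply_of, toAdd_ofAdd]

@[simp] theorem bar_one {n : ℕ} : bar (1 : FreeMetabelian n) = 0 := by
  simp [bar]

@[simp] theorem bar_mul {n : ℕ} (g h : FreeMetabelian n) : bar (g * h) = bar g + bar h := by
  simp [bar]

@[simp] theorem bar_inv {n : ℕ} (g : FreeMetabelian n) : bar g⁻¹ = -bar g := by
  simp [bar]

/-- Two homomorphisms from `M_n` that agree on the generators are equal. -/
theorem hom_ext {n : ℕ} {G : Type*} [Group G] {f f' : FreeMetabelian n →* G}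
    (h : ∀ i, f (gen i) = f' (gen i)) : f = f' := by
  apply QuotientGroup.monoidHom_ext
  apply FreeGroup.ext_hom
  exact h

/-- The inverse of `M_n / M_n' → A_n`. -/
def fromA (n : ℕ) : Multiplicative (A n) →* Abelianization (FreeMetabelian n) where
  toFun a := ∏ i, Abelianization.of (gen i) ^ (a.toAdd i)
  map_one' := by simp
  map_mul' a b := by simp [zpow_add, Finset.prod_mul_distrib]

theorem fromA_bar {n : ℕ} (g : FreeMetabelian n) :
    fromA n (barHom n g) = Abelianization.of g := by
  have : (fromA n).comp (barHom n) = Abelianization.of := by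
    apply hom_ext
    intro i
    have hb : barHom n (gen i) = Multiplicative.ofAdd (e i) := bar_gen i
    simp only [MonoidHom.comp_apply, hb]
    show ∏ j, Abelianization.of (gen j) ^ (e i j) = _
    rw [Finset.prod_eq_single i]
    · simp [e]
    · intro j _ hj
      simp [e, hj]
    · simp
  exact DFunLike.congr_fun this g

theorem bar_eq_zero_iff {n : ℕ} (g : FreeMetabelian n) :
    bar g = 0 ↔ g ∈ commutator (FreeMetabelian n) := by
  constructor
  · intro h
    have h1 : barHom n g = 1 := h
    have h2 := fromA_bar g
    rw [h1, map_one] at h2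
    rw [← Abelianization.ker_of]
    exact h2.symm
  · intro h
    exact Abelianization.commutator_subset_ker (barHom n) h

theorem bar_surjective (n : ℕ) : Function.Surjective (bar : FreeMetabelian n → A n) := by
  intro a
  have key : ∀ a : Multiplicative (A n), a ∈ (barHom n).range := by
    intro a
    have : a = ∏ i, (Multiplicative.ofAdd (e i : A n)) ^ (a.toAdd i) := by
      apply Multiplicative.toAdd.injective
      funext j
      simp [toAdd_prod, e, Finset.sum_apply, Pi.single_apply]
    rw [this]
    refine Subgroup.prod_mem _ fun i _ => Subgroup.zpow_mem _ ?_ _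
    exact MonoidHom.mem_range.2 ⟨gen i, bar_gen i⟩
  exact key (Multiplicative.ofAdd a)

/-! ### 1-chains -/

/-- Integral 1-chains of the graph with vertex set `H` which has, for every vertex `x` and every
label `i : Fin n`, one positive edge `(x, i)`, labelled `a_i` and leaving `x`; the inverse
edge is the chain `-(x, i)`.

For `H = A_n` this is `C_1(Γ_n)`, where `Γ_n` is the Cayley graph of `A_n` and `(x, i)` is the edge
from `x` to `x + ā_i`.  A subgroup `L` acts on `Γ_n` by translations, which keep labels and
orientations, so the edges of `Γ_n / L` are the pairs `(x + L, i)`, and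
`H = A_n ⧸ L` gives `C_1(Γ_n / L)`. -/
abbrev Chains (n : ℕ) (H : Type) : Type := (H × Fin n) →₀ ℤ

/-- The action of the group `H` on 1-chains by translation of edges. -/
noncomputable def shift {n : ℕ} {H : Type} [AddCommGroup H] (h : H) : Chains n H →+ Chains n H :=
  Finsupp.mapDomain.addMonoidHom fun p => (h + p.1, p.2)

/-- The projection `C_1(Γ_n) → C_1(Γ_n / L)`. -/
noncomputable def proj {n : ℕ} (L : AddSubgroup (A n)) : Chains n (A n) →+ Chains n (A n ⧸ L) :=
  Finsupp.mapDomain.addMonoidHom fun p => (QuotientAddGroup.mk p.1, p.2)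

/-- The sum of the edges traversed by the path in `Γ_n` that starts at `x` and is labelled by a
word; the letter `(i, true)` is `a_i` and `(i, false)` is `a_i⁻¹`. -/
noncomputable def pathChain {n : ℕ} : A n → List (Fin n × Bool) → Chains n (A n)
  | _, [] => 0
  | x, (i, true) :: l => Finsupp.single (x, i) 1 + pathChain (x + e i) l
  | x, (i, false) :: l => -Finsupp.single (x - e i, i) 1 + pathChain (x - e i) l

theorem shift_zero {n : ℕ} {H : Type} [AddCommGroup H] (c : Chains n H) : shift 0 c = c := by
  simp only [shift, Finsupp.mapDomain.addMonoidHom, AddMonoidHom.coe_mk, ZeroHom.coe_mk, zero_add]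
  exact Finsupp.mapDomain_id

theorem shift_add {n : ℕ} {H : Type} [AddCommGroup H] (h k : H) (c : Chains n H) :
    shift (h + k) c = shift h (shift k c) := by
  simp only [shift, Finsupp.mapDomain.addMonoidHom, AddMonoidHom.coe_mk, ZeroHom.coe_mk]
  rw [← Finsupp.mapDomain_comp]
  congr 1
  funext p
  simp [add_assoc]

theorem shift_single {n : ℕ} {H : Type} [AddCommGroup H] (h x : H) (i : Fin n) (k : ℤ) :
    shift h (Finsupp.single (x, i) k) = Finsupp.single (h + x, i) k := by
  simp [shift, Finsupp.mapDomain.addMonoidHom]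

/-- The group `C_1(Γ_n) ⋊ A_n`, used to show that the chain of a word depends only on
the element of `M_n`. -/
@[ext] structure ChainExt (n : ℕ) where
  chain : Chains n (A n)
  pt : A n

namespace ChainExt

noncomputable instance (n : ℕ) : Group (ChainExt n) where
  mul x y := ⟨x.chain + shift x.pt y.chain, x.pt + y.pt⟩
  one := ⟨0, 0⟩
  inv x := ⟨-shift (-x.pt) x.chain, -x.pt⟩
  mul_assoc x y z := by
    apply ChainExt.ext
    · show x.chain + shift x.pt y.chain + shift (x.pt + y.pt) z.chain
        = x.chain + shift x.pt (y.chain + shift y.pt z.chain)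
      rw [map_add, shift_add, add_assoc]
    · exact add_assoc _ _ _
  one_mul x := by
    apply ChainExt.ext
    · show 0 + shift 0 x.chain = x.chain
      rw [shift_zero, zero_add]
    · exact zero_add _
  mul_one x := by
    apply ChainExt.ext
    · show x.chain + shift x.pt 0 = x.chain
      rw [map_zero, add_zero]
    · exact add_zero _
  inv_mul_cancel x := by
    apply ChainExt.ext
    · show -shift (-x.pt) x.chain + shift (-x.pt) x.chain = 0
      rw [neg_add_cancel]
    · exact neg_add_cancel _

theorem mul_chain {n : ℕ} (x y : ChainExt n) :
    (x * y).chain = x.chain + shift x.pt y.chain := rfl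

theorem mul_pt {n : ℕ} (x y : ChainExt n) : (x * y).pt = x.pt + y.pt := rfl

/-- The projection to `A_n`. -/
def ptHom (n : ℕ) : ChainExt n →* Multiplicative (A n) where
  toFun x := Multiplicative.ofAdd x.pt
  map_one' := rfl
  map_mul' _ _ := rfl

theorem comm_of_pt {n : ℕ} (x y : ChainExt n) (hx : ptHom n x = 1) (hy : ptHom n y = 1) :
    x * y = y * x := by
  have hx' : x.pt = 0 := hx
  have hy' : y.pt = 0 := hy
  apply ChainExt.ext
  · rw [mul_chain, mul_chain, hx', hy', shift_zero, shift_zero, add_comm]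
  · rw [mul_pt, mul_pt, add_comm]

end ChainExt

/-- The homomorphism `M_n → C_1(Γ_n) ⋊ A_n`, `a_i ↦ ((0, i), ā_i)`; it is `g ↦ (σ(g), ḡ)`. -/
noncomputable def chainHom (n : ℕ) : FreeMetabelian n →* ChainExt n :=
  QuotientGroup.lift _
    (FreeGroup.lift fun i => (⟨Finsupp.single (0, i) 1, e i⟩ : ChainExt n))
    (derivedSeries_two_le_ker _ (ChainExt.ptHom n) ChainExt.comm_of_pt)

/-- The 1-chain `σ(g)` of `g ∈ M_n`: the sum of the edges of `Γ_n` traversed by the path that starts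
at the origin and is labelled by any word representing `g` (see `sigma_mk`). -/
noncomputable def sigma {n : ℕ} (g : FreeMetabelian n) : Chains n (A n) := (chainHom n g).chain

theorem chainHom_pt {n : ℕ} (g : FreeMetabelian n) : (chainHom n g).pt = bar g := by
  have : (ChainExt.ptHom n).comp (chainHom n) = barHom n := by
    apply hom_ext
    intro i
    show Multiplicative.ofAdd (FreeGroup.lift (fun i => (⟨Finsupp.single (0, i) 1, e i⟩ : ChainExt n))
      (FreeGroup.of i)).pt = Multiplicative.ofAdd (bar (gen i))
    rw [FreeGroup.lift_apply_of, bar_gen]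
  exact DFunLike.congr_fun this g

theorem sigma_mul {n : ℕ} (g h : FreeMetabelian n) :
    sigma (g * h) = sigma g + shift (bar g) (sigma h) := by
  rw [sigma, map_mul, ChainExt.mul_chain, chainHom_pt]; rfl

theorem pathChain_eq_shift {n : ℕ} (l : List (Fin n × Bool)) (x : A n) :
    pathChain x l = shift x (pathChain 0 l) := by
  induction l generalizing x with
  | nil => simp [pathChain]
  | cons p l ih =>
    obtain ⟨i, b⟩ := p
    cases b
    · rw [pathChain, pathChain, ih (x - e i), ih (0 - e i), map_add, map_neg, shift_single,
        ← shift_add]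
      simp [sub_eq_add_neg]
    · rw [pathChain, pathChain, ih (x + e i), ih (0 + e i), map_add, shift_single, ← shift_add]
      simp

/-- `σ` of the element of `M_n` represented by a word is the chain of the path of the word. -/
theorem sigma_mk {n : ℕ} (l : List (Fin n × Bool)) :
    sigma (QuotientGroup.mk (FreeGroup.mk l) : FreeMetabelian n) = pathChain 0 l := by
  have hg : ∀ i : Fin n, sigma (gen i) = Finsupp.single (0, i) 1 := by
    intro i
    show (FreeGroup.lift (fun i => (⟨Finsupp.single (0, i) 1, e i⟩ : ChainExt n))
      (FreeGroup.of i)).chain = _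
    rw [FreeGroup.lift_apply_of]
  induction l with
  | nil =>
    show (chainHom n 1).chain = _
    rw [map_one]
    rfl
  | cons p l ih =>
    obtain ⟨i, b⟩ := p
    have hsplit : (QuotientGroup.mk (FreeGroup.mk ((i, b) :: l)) : FreeMetabelian n)
        = QuotientGroup.mk (FreeGroup.mk [(i, b)]) * QuotientGroup.mk (FreeGroup.mk l) := by
      rw [← QuotientGroup.mk_mul, FreeGroup.mul_mk]; rfl
    rw [hsplit, sigma_mul, ih]
    cases b
    · have h1 : (QuotientGroup.mk (FreeGroup.mk [(i, false)]) : FreeMetabelian n) = (gen i)⁻¹ := rfl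
      have h2 : sigma ((gen i)⁻¹ : FreeMetabelian n) = -Finsupp.single (0 - e i, i) 1 := by
        have := sigma_mul (gen i)⁻¹ (gen i)
        rw [inv_mul_cancel, hg, bar_inv, bar_gen, shift_single] at this
        have h0 : sigma (1 : FreeMetabelian n) = 0 := by
          rw [sigma, map_one]; rfl
        rw [h0] at this
        rw [eq_neg_iff_add_eq_zero, this]
        simp
      rw [h1, h2, bar_inv, bar_gen, pathChain, pathChain_eq_shift l (0 - e i), zero_sub]
    · have h1 : (QuotientGroup.mk (FreeGroup.mk [(i, true)]) : FreeMetabelian n) = gen i := rfl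
      rw [h1, hg, bar_gen, pathChain, pathChain_eq_shift l (0 + e i), zero_add]

/-- `τ_L : M_n → C_1(Γ_n) → C_1(Γ_n / L)`. -/
noncomputable def tau {n : ℕ} (L : AddSubgroup (A n)) (g : FreeMetabelian n) :
    Chains n (A n ⧸ L) :=
  proj L (sigma g)

/-! ### The external square -/

/-- The external square `Λ²(A_n)`. -/
abbrev ExtSq (n : ℕ) : Type := ⋀[ℤ]^2 (A n)

/-- The wedge product `u ∧ v` in `Λ²(A_n)`. -/
noncomputable def wedge {n : ℕ} (u v : A n) : ExtSq n := exteriorPower.ιMulti ℤ 2 ![u, v]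

theorem wedge_add_left {n : ℕ} (u u' v : A n) : wedge (u + u') v = wedge u v + wedge u' v := by
  exact (exteriorPower.ιMulti ℤ 2 (M := A n)).map_vecCons_add ![v] u u'

theorem wedge_self {n : ℕ} (u : A n) : wedge u u = 0 :=
  (exteriorPower.ιMulti ℤ 2 (M := A n)).map_eq_zero_of_eq ![u, u] (i := 0) (j := 1) rfl (by simp)

theorem wedge_swap {n : ℕ} (u v : A n) : wedge u v = -wedge v u := by
  have := (exteriorPower.ιMulti ℤ 2 (M := A n)).map_swap ![v, u] (i := 0) (j := 1) (by simp)
  rw [wedge, wedge, ← this]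
  congr 1
  funext i
  fin_cases i <;> simp

theorem wedge_add_right {n : ℕ} (u v v' : A n) : wedge u (v + v') = wedge u v + wedge u v' := by
  rw [wedge_swap, wedge_add_left, neg_add, ← wedge_swap, ← wedge_swap]

/-- The wedge product as a bi-additive map. -/
noncomputable def wedgeHom (n : ℕ) : A n →+ A n →+ ExtSq n :=
  AddMonoidHom.mk' (fun u => AddMonoidHom.mk' (wedge u) (wedge_add_right u))
    fun u u' => AddMonoidHom.ext fun v => wedge_add_left u u' v

/-- The bi-additive map `(u, v) ↦ ∑_{i < j} u_i v_j (ā_i ∧ ā_j)`. -/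
noncomputable def halfWedge {n : ℕ} (u v : A n) : ExtSq n :=
  ∑ i, ∑ j, if i < j then (u i * v j) • wedge (e i) (e j) else 0

theorem halfWedge_add_left {n : ℕ} (u u' v : A n) :
    halfWedge (u + u') v = halfWedge u v + halfWedge u' v := by
  simp only [halfWedge, ← Finset.sum_add_distrib]
  refine Finset.sum_congr rfl fun i _ => Finset.sum_congr rfl fun j _ => ?_
  split_ifs
  · rw [← add_smul, Pi.add_apply, add_mul]
  · simp

theorem halfWedge_add_right {n : ℕ} (u v v' : A n) :
    halfWedge u (v + v') = halfWedge u v + halfWedge u v' := by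
  simp only [halfWedge, ← Finset.sum_add_distrib]
  refine Finset.sum_congr rfl fun i _ => Finset.sum_congr rfl fun j _ => ?_
  split_ifs
  · rw [← add_smul, Pi.add_apply, mul_add]
  · simp

theorem halfWedge_zero_left {n : ℕ} (v : A n) : halfWedge 0 v = 0 := by simp [halfWedge]

theorem halfWedge_zero_right {n : ℕ} (u : A n) : halfWedge u 0 = 0 := by simp [halfWedge]

theorem halfWedge_neg_left {n : ℕ} (u v : A n) : halfWedge (-u) v = -halfWedge u v := by
  rw [eq_neg_iff_add_eq_zero, ← halfWedge_add_left, neg_add_cancel, halfWedge_zero_left]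

theorem halfWedge_sub_swap {n : ℕ} (u v : A n) :
    halfWedge u v - halfWedge v u = wedge u v := by
  have hs : ∀ a : A n, a = ∑ i, a i • e i := by
    intro a
    funext j
    simp [e, Finset.sum_apply, Pi.single_apply]
  have h1 : wedge u v = ∑ i, ∑ j, (u i * v j) • wedge (e i) (e j) := by
    have : wedgeHom n u v = wedgeHom n (∑ i, u i • e i) (∑ j, v j • e j) := by
      rw [← hs, ← hs]
    change wedge u v = _ at this
    rw [this]
    simp only [map_sum, map_zsmul, AddMonoidHom.finsetSum_apply, Finset.smul_sum,
      AddMonoidHom.coe_smul, Pi.smul_apply]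
    rw [Finset.sum_comm]
    refine Finset.sum_congr rfl fun i _ => Finset.sum_congr rfl fun j _ => ?_
    rw [mul_comm, mul_smul]; rfl
  have h2 : halfWedge v u = ∑ i, ∑ j, if j < i then (u i * v j) • wedge (e j) (e i) else 0 := by
    rw [halfWedge, Finset.sum_comm]
    refine Finset.sum_congr rfl fun i _ => Finset.sum_congr rfl fun j _ => ?_
    rw [mul_comm]
  rw [h1, h2, halfWedge]
  simp only [← Finset.sum_sub_distrib]
  refine Finset.sum_congr rfl fun i _ => Finset.sum_congr rfl fun j _ => ?_
  rcases lt_trichotomy i j with h | h | h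
  · simp [h, h.not_gt]
  · subst h; simp [wedge_self]
  · rw [if_neg h.not_gt, if_pos h, wedge_swap (e i) (e j), smul_neg, zero_sub]

/-- The central extension of `A_n` by `Λ²(A_n)` with cocycle `halfWedge`; its commutator
pairing is the wedge product. -/
@[ext] structure WedgeExt (n : ℕ) where
  area : ExtSq n
  pt : A n

namespace WedgeExt

noncomputable instance (n : ℕ) : Group (WedgeExt n) where
  mul x y := ⟨x.area + y.area + halfWedge x.pt y.pt, x.pt + y.pt⟩
  one := ⟨0, 0⟩
  inv x := ⟨-x.area + halfWedge x.pt x.pt, -x.pt⟩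
  mul_assoc x y z := by
    apply WedgeExt.ext
    · show x.area + y.area + halfWedge x.pt y.pt + z.area + halfWedge (x.pt + y.pt) z.pt
        = x.area + (y.area + z.area + halfWedge y.pt z.pt) + halfWedge x.pt (y.pt + z.pt)
      rw [halfWedge_add_left, halfWedge_add_right]
      abel
    · exact add_assoc _ _ _
  one_mul x := by
    apply WedgeExt.ext
    · show 0 + x.area + halfWedge 0 x.pt = x.area
      rw [halfWedge_zero_left, zero_add, add_zero]
    · exact zero_add _
  mul_one x := by
    apply WedgeExt.ext
    · show x.area + 0 + halfWedge x.pt 0 = x.area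
      rw [halfWedge_zero_right, add_zero, add_zero]
    · exact add_zero _
  inv_mul_cancel x := by
    apply WedgeExt.ext
    · show -x.area + halfWedge x.pt x.pt + x.area + halfWedge (-x.pt) x.pt = 0
      rw [halfWedge_neg_left]
      abel
    · exact neg_add_cancel _

theorem mul_area {n : ℕ} (x y : WedgeExt n) :
    (x * y).area = x.area + y.area + halfWedge x.pt y.pt := rfl

theorem mul_pt {n : ℕ} (x y : WedgeExt n) : (x * y).pt = x.pt + y.pt := rfl

/-- The projection to `A_n`. -/
def ptHom (n : ℕ) : WedgeExt n →* Multiplicative (A n) where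
  toFun x := Multiplicative.ofAdd x.pt
  map_one' := rfl
  map_mul' _ _ := rfl

theorem comm_of_pt {n : ℕ} (x y : WedgeExt n) (hx : ptHom n x = 1) (hy : ptHom n y = 1) :
    x * y = y * x := by
  have hx' : x.pt = 0 := hx
  have hy' : y.pt = 0 := hy
  apply WedgeExt.ext
  · rw [mul_area, mul_area, hx', hy', add_comm x.area]
  · rw [mul_pt, mul_pt, add_comm]

end WedgeExt

/-- The homomorphism from `M_n` to the central extension of `A_n` by `Λ²(A_n)` with
`a_i ↦ (0, ā_i)`. -/
noncomputable def wedgeExtHom (n : ℕ) : FreeMetabelian n →* WedgeExt n :=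
  QuotientGroup.lift _
    (FreeGroup.lift fun i => (⟨0, e i⟩ : WedgeExt n))
    (derivedSeries_two_le_ker _ (WedgeExt.ptHom n) WedgeExt.comm_of_pt)

theorem wedgeExtHom_pt {n : ℕ} (g : FreeMetabelian n) : (wedgeExtHom n g).pt = bar g := by
  have : (WedgeExt.ptHom n).comp (wedgeExtHom n) = barHom n := by
    apply hom_ext
    intro i
    show Multiplicative.ofAdd (FreeGroup.lift (fun i => (⟨0, e i⟩ : WedgeExt n))
      (FreeGroup.of i)).pt = Multiplicative.ofAdd (bar (gen i))
    rw [FreeGroup.lift_apply_of, bar_gen]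
  exact DFunLike.congr_fun this g

/-- The epimorphism `φ : M_n' → Λ²(A_n)`.  It is the homomorphism with `φ([g, h]) = ḡ ∧ h̄` for all
`g, h ∈ M_n` (see `phi_commutator`), which determines it, since commutators generate `M_n'`. -/
noncomputable def phi (n : ℕ) : commutator (FreeMetabelian n) →* Multiplicative (ExtSq n) where
  toFun g := Multiplicative.ofAdd (wedgeExtHom n g).area
  map_one' := by
    rw [Subgroup.coe_one, map_one]; rfl
  map_mul' g h := by
    rw [Subgroup.coe_mul, map_mul, WedgeExt.mul_area, wedgeExtHom_pt,
      (bar_eq_zero_iff (g : FreeMetabelian n)).2 g.2, halfWedge_zero_left, add_zero]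
    rfl

theorem phi_commutator {n : ℕ} (g h : FreeMetabelian n)
    (hgh : (g * h * g⁻¹ * h⁻¹) ∈ commutator (FreeMetabelian n)) :
    (phi n ⟨(g * h * g⁻¹ * h⁻¹), hgh⟩).toAdd = wedge (bar g) (bar h) := by
  show (wedgeExtHom n (g * h * g⁻¹ * h⁻¹)).area = _
  have h1 : (g * h * g⁻¹ * h⁻¹) * (h * g) = g * h := by
    group
  have hz := (bar_eq_zero_iff _).2 hgh
  generalize g * h * g⁻¹ * h⁻¹ = k at h1 hz ⊢
  have h2 := congrArg (fun x => (wedgeExtHom n x).area) h1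
  simp only [map_mul, WedgeExt.mul_area, wedgeExtHom_pt, WedgeExt.mul_pt] at h2
  rw [hz, halfWedge_zero_left] at h2
  rw [← halfWedge_sub_swap, eq_sub_iff_add_eq]
  have h3 : (wedgeExtHom n k).area + halfWedge (bar h) (bar g)
      + ((wedgeExtHom n g).area + (wedgeExtHom n h).area)
      = halfWedge (bar g) (bar h) + ((wedgeExtHom n g).area + (wedgeExtHom n h).area) := by
    rw [add_comm (halfWedge (bar g) (bar h)), ← h2]
    abel
  exact add_right_cancel h3

/-! ### The equation -/

/-- The tuple `(u, v, w)` of elements of `M_n` is a solution of the equation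
`[x_1, y_1] ⋯ [x_g, y_g] = z_1 c_1 z_1⁻¹ ⋯ z_m c_m z_m⁻¹`. -/
def IsSolution {n g m : ℕ} (c : Fin m → FreeMetabelian n)
    (u v : Fin g → FreeMetabelian n) (w : Fin m → FreeMetabelian n) : Prop :=
  (List.ofFn fun i => u i * v i * (u i)⁻¹ * (v i)⁻¹).prod = (List.ofFn fun i => w i * c i * (w i)⁻¹).prod

/-- The tuple `(u, v, w)` of elements of `A_n` can be lifted to a solution in `M_n`. -/
def LiftsToSolution {n g m : ℕ} (c : Fin m → FreeMetabelian n)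
    (u v : Fin g → A n) (w : Fin m → A n) : Prop :=
  ∃ (U V : Fin g → FreeMetabelian n) (W : Fin m → FreeMetabelian n),
    (∀ i, bar (U i) = u i) ∧ (∀ i, bar (V i) = v i) ∧ (∀ i, bar (W i) = w i) ∧
      IsSolution c U V W

/-- The subgroup `L` of `A_n` generated by all `u_i`, `v_i` and `c̄_i`. -/
def subgroupL {n g m : ℕ} (c : Fin m → FreeMetabelian n) (u v : Fin g → A n) :
    AddSubgroup (A n) :=
  AddSubgroup.closure (Set.range u ∪ Set.range v ∪ Set.range fun i => bar (c i))

/-- The condition `∑ w_i τ_L(c_i) = 0` in `C_1(Γ_n / L)`; here `A_n` acts on `C_1(Γ_n / L)`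
by translations, through `A_n ⧸ L`. -/
def CoefficientCondition {n g m : ℕ} (c : Fin m → FreeMetabelian n)
    (u v : Fin g → A n) (w : Fin m → A n) : Prop :=
  ∑ i, shift (QuotientAddGroup.mk (w i) : A n ⧸ subgroupL c u v) (tau (subgroupL c u v) (c i)) = 0

/-- The condition `∑ u_i ∧ v_i = ∑ w_i ∧ c̄_i + φ(c_1 ⋯ c_m)` in `Λ²(A_n)`, for coefficients with
`c_1 ⋯ c_m ∈ M_n'`. -/
def HomologyCondition {n g m : ℕ} (c : Fin m → FreeMetabelian n)
    (hc : (List.ofFn c).prod ∈ commutator (FreeMetabelian n))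
    (u v : Fin g → A n) (w : Fin m → A n) : Prop :=
  ∑ i, wedge (u i) (v i) = ∑ i, wedge (w i) (bar (c i)) + (phi n ⟨(List.ofFn c).prod, hc⟩).toAdd

end FreeMetabelian

/-! Let N be the preimage of L in M_n. Two invariants detect everything: the chain τ_L, which is
additive on N because N translates Γ_n/L trivially, and the area, the Λ²(A_n)-coordinate of the
image in a central extension of A_n, which extends φ. Evaluated on the two sides of a solution they
give (1) and (2).

Conversely, lift the tuple arbitrarily to U, V, W and let P and Q be the resulting two sides.
Changing the lifts by elements of M_n' multiplies P and Q, independently up to a common normal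
subgroup D, by products of commutators of M_n' with the U_i, V_i, c_i; D (`corrections`) is
generated by all of these. So it suffices that k = P⁻¹Q lies in D. Now (1) gives τ_L(k) = 0, hence k
∈ N' by a Schreier transversal argument (`mem_commutator_preimage_of_tau_eq_zero`). Modulo D the
subgroup M_n' is central in N, so N/D is a central extension of L and the class of k is the image of
some ω ∈ Λ²(L). The area of k is the image of ω in Λ²(A_n), and it vanishes by (2). As L is a
subgroup of a free abelian group of finite rank, Λ²(L) → Λ²(A_n) is injective; thus ω = 0 and k ∈ D
(`mem_of_area_eq_zero`). -/

open scoped commutatorElement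

/-! ### Exterior powers of submodules over a principal ideal domain -/

/-- A scalar endomorphism `d` acts on the `k`-th exterior power as `d ^ k`. -/
theorem exteriorPower_map_smul_id {R M : Type*} [CommRing R] [AddCommGroup M] [Module R M]
    (k : ℕ) (d : R) :
    exteriorPower.map k (d • (LinearMap.id : M →ₗ[R] M)) = d ^ k • LinearMap.id := by
  apply exteriorPower.linearMap_ext
  ext v
  simp only [LinearMap.compAlternatingMap_apply, exteriorPower.map_apply_ιMulti]
  congr 1
  have := (exteriorPower.ιMulti R k (M := M)).toMultilinearMap.map_smul_univ (fun _ => d) v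
  simpa [Function.comp_def] using this

/-- The inclusion of a submodule of a finite free module over a principal ideal domain
induces injections on exterior powers. -/
theorem exteriorPower_map_subtype_injective {R M : Type*} [CommRing R] [IsDomain R]
    [IsPrincipalIdealRing R] [AddCommGroup M] [Module R M] [Module.Free R M] [Module.Finite R M]
    (k : ℕ) (N : Submodule R M) : Function.Injective (exteriorPower.map k N.subtype) := by
  classical
  obtain ⟨r, bM, bN, f, a, snf⟩ := N.smithNormalForm (Module.Free.chooseBasis R M)
  have ha : ∀ i, a i ≠ 0 := by
    intro i h
    have h1 := snf i
    rw [h, zero_smul] at h1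
    exact bN.ne_zero i (Subtype.ext h1)
  set d : R := ∏ i, a i with hd
  have hd0 : d ≠ 0 := Finset.prod_ne_zero_iff.2 fun i _ => ha i
  -- In Smith normal form `bN i = a i • bM (f i)`. The map `p` sends `bM (f i)` to `(d / a i) • bN
  -- i` and the other basis vectors to 0, so that it inverts the inclusion up to the factor `d`.
  let p : M →ₗ[R] N := bM.constr R fun j =>
    if h : ∃ i, f i = j then (∏ i ∈ Finset.univ.erase h.choose, a i) • bN h.choose else 0
  have hp : p ∘ₗ N.subtype = d • LinearMap.id := by
    apply bN.ext
    intro i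
    have hex : ∃ i', f i' = f i := ⟨i, rfl⟩
    have hi : hex.choose = i := f.injective hex.choose_spec
    have h1 : p (bM (f i)) = (∏ i' ∈ Finset.univ.erase i, a i') • bN i := by
      rw [Module.Basis.constr_basis, dif_pos hex, hi]
    rw [LinearMap.comp_apply, Submodule.subtype_apply, snf, map_smul, h1, smul_smul,
      Finset.mul_prod_erase _ _ (Finset.mem_univ i)]
    rfl
  have hcomp : exteriorPower.map k p ∘ₗ exteriorPower.map k N.subtype
      = d ^ k • LinearMap.id := by
    rw [← exteriorPower.map_comp, hp, exteriorPower_map_smul_id]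
  rw [← LinearMap.ker_eq_bot, LinearMap.ker_eq_bot']
  intro x hx
  have h2 := LinearMap.congr_fun hcomp x
  rw [LinearMap.comp_apply, hx, map_zero] at h2
  -- The exterior power of the free module `N` is torsion-free, so `d ^ k` acts injectively on it.
  have : Module.Free R N := Module.Free.of_basis bN
  exact (smul_eq_zero.1 h2.symm).resolve_left (pow_ne_zero k hd0)

/-- An injective linear map to a finite free module over a principal ideal domain
induces injections on exterior powers. -/
theorem exteriorPower_map_injective {R M N : Type*} [CommRing R] [IsDomain R]
    [IsPrincipalIdealRing R] [AddCommGroup M] [Module R M] [Module.Free R M] [Module.Finite R M]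
    [AddCommGroup N] [Module R N] (k : ℕ) (f : N →ₗ[R] M) (hf : Function.Injective f) :
    Function.Injective (exteriorPower.map k f) := by
  have h : f = (LinearMap.range f).subtype ∘ₗ (LinearEquiv.ofInjective f hf).toLinearMap := rfl
  rw [h, exteriorPower.map_comp, LinearMap.coe_comp]
  refine (exteriorPower_map_subtype_injective k _).comp
    (exteriorPower.map_injective (LinearEquiv.ofInjective f hf).symm.toLinearMap ?_)
  ext x
  simp

/-! ### Commutator pairings of central extensions -/

/-- The alternating map attached to a bi-additive map that vanishes on the diagonal. -/
def alternatingMapOfBiadditive {L C : Type*} [AddCommGroup L] [AddCommGroup C]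
    (b : L →+ L →+ C) (hb : ∀ x, b x x = 0) : L [⋀^Fin 2]→ₗ[ℤ] C where
  toFun v := b (v 0) (v 1)
  map_update_add' v i x y := by
    fin_cases i <;> simp [Function.update]
  map_update_smul' v i t x := by
    fin_cases i <;> simp [Function.update]
  map_eq_zero_of_eq' v i j h hij := by
    fin_cases i <;> fin_cases j <;> simp_all

/-- A bimultiplicative alternating function of pairs of elements of a group `H`, whose values
depend only on the images in an abelian quotient `L`, factors through `Λ²(L)`. -/
theorem exists_exteriorSquare_lift {H L C : Type*} [Group H] [AddCommGroup L] [AddCommGroup C]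
    (p : H →* Multiplicative L) (hp : Function.Surjective p) (P : H → H → C)
    (hPl : ∀ x x' y, P (x * x') y = P x y + P x' y)
    (hPr : ∀ x y y', P x (y * y') = P x y + P x y')
    (hPs : ∀ x, P x x = 0) (hPkl : ∀ x y, p x = 1 → P x y = 0) (hPkr : ∀ x y, p y = 1 → P x y = 0) :
    ∃ β : ⋀[ℤ]^2 L →+ C, ∀ x y : H,
      β (exteriorPower.ιMulti ℤ 2 ![(p x).toAdd, (p y).toAdd]) = P x y := by
  have hker : ∀ x x', p x = p x' → p (x⁻¹ * x') = 1 := fun x x' h => by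
    rw [map_mul, map_inv, h, inv_mul_cancel]
  have hcl : ∀ x x' y, p x = p x' → P x y = P x' y := fun x x' y h => by
    rw [← mul_inv_cancel_left x x', hPl, hPkl _ _ (hker x x' h), add_zero]
  have hcr : ∀ x y y', p y = p y' → P x y = P x y' := fun x y y' h => by
    rw [← mul_inv_cancel_left y y', hPr, hPkr _ _ (hker y y' h), add_zero]
  -- A set-theoretic section suffices: `P` sees only images in `L`, so the failure of `s` to be a
  -- homomorphism does not matter.
  let s : L → H := fun l => Function.surjInv hp (Multiplicative.ofAdd l)
  have hs : ∀ l, p (s l) = Multiplicative.ofAdd l := fun l => Function.surjInv_eq hp _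
  have hsadd : ∀ l l', p (s (l + l')) = p (s l * s l') := fun l l' => by
    rw [map_mul, hs, hs, hs, ofAdd_add]
  let b : L →+ L →+ C :=
    AddMonoidHom.mk' (fun l => AddMonoidHom.mk' (fun l' => P (s l) (s l'))
      fun l' l'' => by rw [hcr _ _ _ (hsadd l' l''), hPr])
      fun l l' => AddMonoidHom.ext fun l'' => by
        show P (s (l + l')) (s l'') = P (s l) (s l'') + P (s l') (s l'')
        rw [hcl _ _ _ (hsadd l l'), hPl]
  have hb : ∀ l, b l l = 0 := fun l => hPs _
  refine ⟨(exteriorPower.alternatingMapLinearEquiv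
    (alternatingMapOfBiadditive b hb)).toAddMonoidHom, fun x y => ?_⟩
  show (exteriorPower.alternatingMapLinearEquiv (alternatingMapOfBiadditive b hb))
      (exteriorPower.ιMulti ℤ 2 ![(p x).toAdd, (p y).toAdd]) = P x y
  rw [exteriorPower.alternatingMapLinearEquiv_apply_ιMulti]
  show P (s (p x).toAdd) (s (p y).toAdd) = P x y
  exact (hcl _ x _ (hs _)).trans (hcr _ _ y (hs _))

/-- In a central extension of an abelian group `L`, the commutator of two elements is a function of
their wedge product in `Λ²(L)`. -/
theorem exists_commutatorPairing {H L : Type*} [Group H] [AddCommGroup L]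
    (p : H →* Multiplicative L) (hp : Function.Surjective p) (hc : p.ker ≤ Subgroup.center H) :
    ∃ β : Multiplicative (⋀[ℤ]^2 L) →* H, ∀ x y : H,
      β (Multiplicative.ofAdd (exteriorPower.ιMulti ℤ 2 ![(p x).toAdd, (p y).toAdd])) = ⁅x, y⁆ := by
  have hmem : ∀ x y : H, ⁅x, y⁆ ∈ Subgroup.center H := fun x y => hc <| by
    rw [MonoidHom.mem_ker, map_commutatorElement, commutatorElement_eq_one_iff_mul_comm, mul_comm]
  have hconj : ∀ z ∈ Subgroup.center H, ∀ x, x * z * x⁻¹ = z := fun z hz x => by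
    rw [Subgroup.mem_center_iff.1 hz x, mul_inv_cancel_right]
  let _ : CommGroup (Subgroup.center H) :=
    { mul_comm := fun a b => Subtype.ext (Subgroup.mem_center_iff.1 b.2 a) }
  obtain ⟨β, hβ⟩ := exists_exteriorSquare_lift (C := Additive (Subgroup.center H)) p hp
    (fun x y => Additive.ofMul ⟨⁅x, y⁆, hmem x y⟩)
    (fun x x' y => by
      apply Additive.toMul.injective
      apply Subtype.ext
      show ⁅x * x', y⁆ = ⁅x, y⁆ * ⁅x', y⁆
      rw [commutatorElement_mul_left_eq_conj_mul, hconj _ (hmem _ _),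
        Subgroup.mem_center_iff.1 (hmem x y)])
    (fun x y y' => by
      apply Additive.toMul.injective
      apply Subtype.ext
      show ⁅x, y * y'⁆ = ⁅x, y⁆ * ⁅x, y'⁆
      rw [commutatorElement_mul_right_eq_mul_conj, mul_assoc, mul_assoc, ← mul_assoc y,
        hconj _ (hmem _ _)])
    (fun x => by
      apply Additive.toMul.injective
      exact Subtype.ext (commutatorElement_self x))
    (fun x y hx => by
      apply Additive.toMul.injective
      apply Subtype.ext
      show ⁅x, y⁆ = 1
      rw [commutatorElement_eq_one_iff_mul_comm, Subgroup.mem_center_iff.1 (hc hx)])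
    (fun x y hy => by
      apply Additive.toMul.injective
      apply Subtype.ext
      show ⁅x, y⁆ = 1
      rw [commutatorElement_eq_one_iff_mul_comm, Subgroup.mem_center_iff.1 (hc hy)])
  refine ⟨(Subgroup.center H).subtype.comp (AddMonoidHom.toMultiplicativeLeft β), fun x y => ?_⟩
  exact congrArg (fun z => ((Additive.toMul z : Subgroup.center H) : H)) (hβ x y)

/-! ### Chains in the quotient graph and the derived subgroup of N -/

namespace FreeMetabelian

theorem sigma_one {n : ℕ} : sigma (1 : FreeMetabelian n) = 0 := by
  rw [sigma, map_one]; rfl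

theorem sigma_gen {n : ℕ} (i : Fin n) : sigma (gen i) = Finsupp.single (0, i) 1 := by
  refine (sigma_mk [(i, true)]).trans ?_
  rw [pathChain, pathChain, add_zero]

@[elab_as_elim]
theorem induction_gen {n : ℕ} {P : FreeMetabelian n → Prop} (g : FreeMetabelian n)
    (one : P 1) (gen : ∀ i, P (gen i)) (mul : ∀ g h, P g → P h → P (g * h))
    (inv : ∀ g, P g → P g⁻¹) : P g := by
  obtain ⟨f, rfl⟩ := QuotientGroup.mk_surjective g
  exact FreeGroup.induction_on (C := fun f => P (QuotientGroup.mk f)) f one gen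
    (fun i h => inv _ h) (fun f f' h h' => mul _ _ h h')

theorem proj_shift {n : ℕ} (L : AddSubgroup (A n)) (a : A n) (c : Chains n (A n)) :
    proj L (shift a c) = shift (QuotientAddGroup.mk a : A n ⧸ L) (proj L c) := by
  simp only [proj, shift, Finsupp.mapDomain.addMonoidHom, AddMonoidHom.coe_mk, ZeroHom.coe_mk]
  rw [← Finsupp.mapDomain_comp, ← Finsupp.mapDomain_comp]
  rfl

theorem proj_single {n : ℕ} (L : AddSubgroup (A n)) (x : A n) (i : Fin n) (k : ℤ) :
    proj L (Finsupp.single (x, i) k) = Finsupp.single (QuotientAddGroup.mk x, i) k := by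
  simp [proj, Finsupp.mapDomain.addMonoidHom]

theorem tau_one {n : ℕ} (L : AddSubgroup (A n)) : tau L (1 : FreeMetabelian n) = 0 := by
  rw [tau, sigma_one, map_zero]

theorem tau_mul {n : ℕ} (L : AddSubgroup (A n)) (g h : FreeMetabelian n) :
    tau L (g * h) = tau L g + shift (QuotientAddGroup.mk (bar g)) (tau L h) := by
  rw [tau, sigma_mul, map_add, proj_shift]; rfl

/-- The preimage of `L ≤ A_n` in `M_n`. -/
def preimage {n : ℕ} (L : AddSubgroup (A n)) : Subgroup (FreeMetabelian n) :=
  (AddSubgroup.toSubgroup L).comap (barHom n)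

theorem mem_preimage {n : ℕ} {L : AddSubgroup (A n)} {g : FreeMetabelian n} :
    g ∈ preimage L ↔ bar g ∈ L := Iff.rfl

/-- Elements of the preimage `N` of `L` whose chain in `Γ_n / L` vanishes lie in `N'`: a
transversal of `N` defines a map from `C_1(Γ_n / L)` to the abelianization of `N`, which
sends `τ_L(k)` to the class of `k`. -/
theorem mem_commutator_preimage_of_tau_eq_zero {n : ℕ} (L : AddSubgroup (A n))
    (k : preimage L) (hk : tau L (k : FreeMetabelian n) = 0) :
    k ∈ commutator (preimage L) := by
  have hsurj : ∀ x : A n ⧸ L, ∃ g : FreeMetabelian n, (QuotientAddGroup.mk (bar g) : A n ⧸ L) = x := by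
    intro x
    obtain ⟨a, rfl⟩ := QuotientAddGroup.mk_surjective x
    obtain ⟨g, rfl⟩ := bar_surjective n a
    exact ⟨g, rfl⟩
  choose s hs using hsurj
  have hmem : ∀ (x : A n ⧸ L) (g : FreeMetabelian n),
      s x * g * (s (x + QuotientAddGroup.mk (bar g)))⁻¹ ∈ preimage L := by
    intro x g
    rw [mem_preimage, ← QuotientAddGroup.eq_zero_iff, bar_mul, bar_mul, bar_inv,
      QuotientAddGroup.mk_add, QuotientAddGroup.mk_add, QuotientAddGroup.mk_neg, hs, hs,
      add_neg_cancel]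
  -- Schreier elements: the path labelled `g` from the vertex `x`, closed up by the coset
  -- representatives of its two ends.
  let θ : A n ⧸ L → FreeMetabelian n → preimage L := fun x g => ⟨_, hmem x g⟩
  have hθmul : ∀ x g h, θ x (g * h) = θ x g * θ (x + QuotientAddGroup.mk (bar g)) h := by
    intro x g h
    apply Subtype.ext
    show s x * (g * h) * (s (x + QuotientAddGroup.mk (bar (g * h))))⁻¹
      = s x * g * (s (x + QuotientAddGroup.mk (bar g)))⁻¹
        * (s (x + QuotientAddGroup.mk (bar g)) * h
          * (s (x + QuotientAddGroup.mk (bar g) + QuotientAddGroup.mk (bar h)))⁻¹)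
    rw [bar_mul, QuotientAddGroup.mk_add, add_assoc]
    group
  have hθone : ∀ x, θ x 1 = 1 := by
    intro x
    have := hθmul x 1 1
    rw [mul_one, bar_one, QuotientAddGroup.mk_zero, add_zero] at this
    exact (left_eq_mul.1 this)
  let ρ : Chains n (A n ⧸ L) →+ Additive (Abelianization (preimage L)) :=
    Finsupp.liftAddHom fun q =>
      zmultiplesHom _ (Additive.ofMul (Abelianization.of (θ q.1 (gen q.2))))
  have hρ : ∀ (g : FreeMetabelian n) (x : A n ⧸ L),
      ρ (shift x (tau L g)) = Additive.ofMul (Abelianization.of (θ x g)) := by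
    intro g
    induction g using induction_gen with
    | one => intro x; rw [tau_one, map_zero, map_zero, hθone, map_one]; rfl
    | gen i =>
      intro x
      rw [tau, sigma_gen, proj_single, shift_single, QuotientAddGroup.mk_zero, add_zero]
      simp [ρ]
    | mul g h hg hh =>
      intro x
      rw [tau_mul, map_add, ← shift_add, map_add, hg, hh, hθmul, map_mul]
      rfl
    | inv g hg =>
      intro x
      -- The path of `g` that ends at `x` starts at `x - ḡ`. Followed by the path of `g⁻¹` from `x`
      -- it contributes nothing on either side.
      have h1 := hθmul (x - QuotientAddGroup.mk (bar g)) g g⁻¹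
      have h2 := tau_mul L g g⁻¹
      rw [mul_inv_cancel, hθone, sub_add_cancel] at h1
      rw [mul_inv_cancel, tau_one] at h2
      have h3 := congrArg (fun c => ρ (shift (x - QuotientAddGroup.mk (bar g)) c)) h2
      simp only [map_add, ← shift_add, map_zero, sub_add_cancel, hg] at h3
      have h4 := congrArg (fun y => Additive.ofMul (Abelianization.of y)) h1
      simp only [map_mul, map_one, ofMul_mul, ofMul_one] at h4
      exact add_left_cancel (h3.symm.trans h4)
  have h1 := hρ k 0
  have hk0 : (QuotientAddGroup.mk (bar (k : FreeMetabelian n)) : A n ⧸ L) = 0 :=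
    (QuotientAddGroup.eq_zero_iff _).2 k.2
  have hs0 : s 0 ∈ preimage L := by
    rw [mem_preimage, ← QuotientAddGroup.eq_zero_iff, hs]
  -- The representative `s 0` need not be 1, but it lies in N, so the conjugation is invisible in
  -- the abelianization.
  have h2 : θ 0 (k : FreeMetabelian n) = ⟨s 0, hs0⟩ * k * ⟨s 0, hs0⟩⁻¹ := by
    apply Subtype.ext
    show s 0 * (k : FreeMetabelian n) * (s (0 + QuotientAddGroup.mk (bar (k : FreeMetabelian n))))⁻¹ = _
    rw [hk0, add_zero]
    rfl
  have h3 : Abelianization.of (⟨s 0, hs0⟩ * k * ⟨s 0, hs0⟩⁻¹) = Abelianization.of k := by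
    rw [map_mul, map_mul, map_inv, mul_inv_cancel_comm]
  rw [hk, map_zero, map_zero, h2, h3] at h1
  rw [← Abelianization.ker_of]
  exact h1.symm

end FreeMetabelian

/-! ### Commutators with the derived subgroup of a metabelian group -/

/-- In a metabelian group, the commutators `[s, x]` with `s` in the derived subgroup form
a subgroup. -/
def derivedCommutators {G : Type*} [Group G]
    (hG : ∀ s ∈ commutator G, ∀ t ∈ commutator G, s * t = t * s) (x : G) : Subgroup G where
  carrier := {d | ∃ s ∈ commutator G, ⁅s, x⁆ = d}
  one_mem' := ⟨1, one_mem _, commutatorElement_one_left x⟩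
  mul_mem' := by
    rintro _ _ ⟨s, hs, rfl⟩ ⟨t, ht, rfl⟩
    refine ⟨s * t, mul_mem hs ht, ?_⟩
    have h : ⁅t, x⁆ ∈ commutator G := Subgroup.commutator_mem_commutator trivial trivial
    have h' : ⁅s, x⁆ ∈ commutator G := Subgroup.commutator_mem_commutator trivial trivial
    rw [commutatorElement_mul_left_eq_conj_mul, hG _ hs _ h, mul_inv_cancel_right, hG _ h _ h']
  inv_mem' := by
    rintro _ ⟨s, hs, rfl⟩
    refine ⟨s⁻¹, inv_mem hs, ?_⟩
    have h : ⁅x, s⁆ ∈ commutator G := Subgroup.commutator_mem_commutator trivial trivial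
    rw [commutatorElement_inv_left, mul_assoc, hG _ h _ hs, inv_mul_cancel_left,
      commutatorElement_inv]

theorem commutatorElement_mem_commutator {G : Type*} [Group G] (x y : G) :
    ⁅x, y⁆ ∈ commutator G :=
  Subgroup.commutator_mem_commutator trivial trivial

/-- For `s` in the derived subgroup of a metabelian group, `[s, y]` only depends on the image of
`y` in the abelianization. -/
theorem commutatorElement_mul_of_mem_commutator {G : Type*} [Group G]
    (hG : ∀ s ∈ commutator G, ∀ t ∈ commutator G, s * t = t * s) {s t : G}
    (hs : s ∈ commutator G) (ht : t ∈ commutator G) (x : G) : ⁅s, t * x⁆ = ⁅s, x⁆ := by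
  rw [commutatorElement_mul_right_eq_mul_conj, commutatorElement_eq_one_iff_mul_comm.2 (hG s hs t ht),
    one_mul, hG t ht _ (commutatorElement_mem_commutator s x), mul_inv_cancel_right]

theorem derivedCommutators_mul {G : Type*} [Group G]
    (hG : ∀ s ∈ commutator G, ∀ t ∈ commutator G, s * t = t * s) {t : G}
    (ht : t ∈ commutator G) (x : G) :
    derivedCommutators hG (t * x) = derivedCommutators hG x := by
  ext d
  refine exists_congr fun s => and_congr_right fun hs => ?_
  rw [commutatorElement_mul_of_mem_commutator hG hs ht]

/-- Conjugation by `g` turns `[s, x]` into `[gsg⁻¹, [g, x]x]`, and the factor `[g, x]` can be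
dropped because it commutes with `gsg⁻¹`. -/
theorem derivedCommutators_normal {G : Type*} [Group G]
    (hG : ∀ s ∈ commutator G, ∀ t ∈ commutator G, s * t = t * s) (x : G) :
    (derivedCommutators hG x).Normal := by
  refine ⟨?_⟩
  rintro _ ⟨s, hs, rfl⟩ g
  have hs' : g * s * g⁻¹ ∈ commutator G := Subgroup.Normal.conj_mem inferInstance _ hs _
  refine ⟨g * s * g⁻¹, hs', ?_⟩
  rw [conjugate_commutatorElement,
    ← commutatorElement_mul_of_mem_commutator hG hs' (commutatorElement_mem_commutator g x) x]
  congr 1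
  rw [commutatorElement_def]
  group

theorem derivedCommutators_le {G : Type*} [Group G]
    (hG : ∀ s ∈ commutator G, ∀ t ∈ commutator G, s * t = t * s) (x : G) :
    derivedCommutators hG x ≤ commutator G := by
  rintro _ ⟨s, -, rfl⟩
  exact commutatorElement_mem_commutator s x

/-- Multiplying `x` and `y` by elements of the derived subgroup of a metabelian group multiplies
`[x, y]` by an arbitrary product of commutators of `x` and of `y` with such elements. -/
theorem exists_commutatorElement_eq_mul {G : Type*} [Group G]
    (hG : ∀ s ∈ commutator G, ∀ t ∈ commutator G, s * t = t * s) (x y d : G)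
    (hd : d ∈ derivedCommutators hG x ⊔ derivedCommutators hG y) :
    ∃ s ∈ commutator G, ∃ t ∈ commutator G, ⁅s * x, t * y⁆ = ⁅x, y⁆ * d := by
  have := derivedCommutators_normal hG y
  obtain ⟨d₁, hd₁, d₂, ⟨s, hs, rfl⟩, rfl⟩ := Subgroup.mem_sup_of_normal_right.1 hd
  -- The inverse is needed because `t` enters in the second slot, through `[x, t] = [t, x]⁻¹`.
  obtain ⟨t, ht, htd⟩ := inv_mem hd₁
  refine ⟨s, hs, t, ht, ?_⟩
  have h1 : ⁅s * x, t * y⁆ = ⁅x, t * y⁆ * ⁅s, y⁆ := by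
    rw [commutatorElement_mul_left_eq_conj_mul, hG s hs _ (commutatorElement_mem_commutator _ _),
      mul_inv_cancel_right, commutatorElement_mul_of_mem_commutator hG hs ht]
  have h2 : ⁅x, t * y⁆ = ⁅x, y⁆ * d₁ := by
    rw [commutatorElement_mul_right_eq_mul_conj, mul_assoc, mul_assoc, ← mul_assoc t,
      hG t ht _ (commutatorElement_mem_commutator _ _), mul_inv_cancel_right,
      hG _ (commutatorElement_mem_commutator _ _) _ (commutatorElement_mem_commutator _ _),
      ← commutatorElement_inv t x, htd, inv_inv]
  rw [h1, h2, mul_assoc]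

/-- Multiplying `w` by elements of the derived subgroup of a metabelian group multiplies
the conjugate `w c w⁻¹` by an arbitrary commutator of `c` with such an element. -/
theorem exists_conj_eq_mul {G : Type*} [Group G]
    (hG : ∀ s ∈ commutator G, ∀ t ∈ commutator G, s * t = t * s) (w c d : G)
    (hd : d ∈ derivedCommutators hG c) :
    ∃ s ∈ commutator G, (s * w) * c * (s * w)⁻¹ = w * c * w⁻¹ * d := by
  have h : w * c * w⁻¹ = ⁅w, c⁆ * c := by
    rw [commutatorElement_def, inv_mul_cancel_right]
  rw [← derivedCommutators_mul hG (commutatorElement_mem_commutator w c), ← h] at hd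
  obtain ⟨s, hs, rfl⟩ := hd
  -- With `y = w c w⁻¹` and `d = [s, y]`, the product `y d` equals `y s y s⁻¹ y⁻¹`, the conjugate of
  -- `y` by `y s y⁻¹`.
  refine ⟨(w * c * w⁻¹) * s * (w * c * w⁻¹)⁻¹, Subgroup.Normal.conj_mem inferInstance _ hs _, ?_⟩
  rw [commutatorElement_def]
  group

/-- If the `i`-th factor of a product may be multiplied by any element of a normal subgroup
`D i`, then the product may be multiplied by any element of the join of the `D i`. -/
theorem exists_prod_ofFn_eq_mul {G : Type*} [Group G] {k : ℕ} (D : Fin k → Subgroup G)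
    (hD : ∀ i, (D i).Normal) (X : Fin k → Set G) (x : Fin k → G)
    (hX : ∀ i, ∀ d ∈ D i, x i * d ∈ X i) (d : G) (hd : d ∈ ⨆ i, D i) :
    ∃ y : Fin k → G, (∀ i, y i ∈ X i) ∧ (List.ofFn y).prod = (List.ofFn x).prod * d := by
  induction k generalizing d with
  | zero =>
    rw [iSup_of_empty, Subgroup.mem_bot] at hd
    exact ⟨x, fun i => i.elim0, by rw [hd, mul_one]⟩
  | succ k ih =>
    have hsup : ⨆ i, D i ≤ D 0 ⊔ ⨆ i : Fin k, D i.succ := by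
      refine iSup_le fun i => ?_
      refine Fin.cases le_sup_left (fun i => ?_) i
      exact (le_iSup (fun i : Fin k => D i.succ) i).trans le_sup_right
    have := hD 0
    obtain ⟨d₀, hd₀, d', hd', rfl⟩ := Subgroup.mem_sup_of_normal_left.1 (hsup hd)
    obtain ⟨y, hy, hprod⟩ := ih (fun i => D i.succ) (fun i => hD _) (fun i => X i.succ)
      (fun i => x i.succ) (fun i => hX _) d' hd'
    set R := (List.ofFn fun i : Fin k => x i.succ).prod with hR
    -- Conjugating `d₀` by the remaining product `R` lets it pass to the right of `R`; normality
    -- keeps it in `D 0`.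
    refine ⟨Fin.cons (x 0 * (R * d₀ * R⁻¹)) y, fun i => ?_, ?_⟩
    · refine Fin.cases ?_ (fun i => ?_) i
      · exact hX 0 _ ((hD 0).conj_mem _ hd₀ _)
      · exact hy i
    · simp only [List.ofFn_succ, List.prod_cons, Fin.cons_zero, Fin.cons_succ, hprod, ← hR]
      group

/-- The elements that commute with the derived subgroup modulo a normal subgroup `D`. -/
def derivedCentralizer {G : Type*} [Group G] (D : Subgroup G) [hD : D.Normal] : Subgroup G where
  carrier := {x | ∀ s ∈ commutator G, ⁅s, x⁆ ∈ D}
  one_mem' s _ := by rw [commutatorElement_one_right]; exact one_mem D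
  mul_mem' {x y} hx hy s hs := by
    rw [commutatorElement_mul_right_eq_mul_conj, mul_assoc, mul_assoc, ← mul_assoc x]
    exact mul_mem (hx s hs) (hD.conj_mem _ (hy s hs) x)
  inv_mem' {x} hx s hs := by
    rw [commutatorElement_inv_right, ← commutatorElement_inv s x]
    simpa using hD.conj_mem _ (inv_mem (hx s hs)) x⁻¹

theorem commutator_le_derivedCentralizer {G : Type*} [Group G]
    (hG : ∀ s ∈ commutator G, ∀ t ∈ commutator G, s * t = t * s) (D : Subgroup G) [D.Normal] :
    commutator G ≤ derivedCentralizer D := fun x hx s hs => by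
  rw [commutatorElement_eq_one_iff_mul_comm.2 (hG s hs x hx)]
  exact one_mem D

/-! ### Zero chain and zero area force membership in D -/

namespace FreeMetabelian

theorem mul_comm_of_mem_commutator {n : ℕ} (s : FreeMetabelian n)
    (hs : s ∈ commutator (FreeMetabelian n)) (t : FreeMetabelian n)
    (ht : t ∈ commutator (FreeMetabelian n)) : s * t = t * s := by
  have hmap : (commutator (FreeGroup (Fin n))).map
      (QuotientGroup.mk' (derivedSeries (FreeGroup (Fin n)) 2)) = commutator (FreeMetabelian n) := by
    rw [commutator_def, commutator_def, Subgroup.map_commutator,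
      Subgroup.map_top_of_surjective _ (QuotientGroup.mk'_surjective _)]
  rw [← hmap] at hs ht
  obtain ⟨s, hs, rfl⟩ := hs
  obtain ⟨t, ht, rfl⟩ := ht
  rw [← commutatorElement_eq_one_iff_mul_comm, ← map_commutatorElement]
  apply (QuotientGroup.eq_one_iff _).2
  rw [derivedSeries_succ, derivedSeries_one]
  exact Subgroup.commutator_mem_commutator hs ht

theorem mul_inv_mem_commutator_of_bar_eq {n : ℕ} {g h : FreeMetabelian n} (hgh : bar g = bar h) :
    g * h⁻¹ ∈ commutator (FreeMetabelian n) := by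
  rw [← bar_eq_zero_iff, bar_mul, bar_inv, hgh, add_neg_cancel]

/-- If the elements `ḡ` with `g` commuting with `M_n'` modulo `D` include generators of `L`, then
the preimage of `L` commutes with `M_n'` modulo `D`. -/
theorem preimage_closure_le_derivedCentralizer {n : ℕ} (D : Subgroup (FreeMetabelian n)) [D.Normal]
    (S : Set (A n)) (hS : ∀ a ∈ S, ∃ g ∈ derivedCentralizer D, bar g = a) :
    preimage (AddSubgroup.closure S) ≤ derivedCentralizer D := by
  -- Since the centralizer contains `M_n'`, membership in it depends only on the image in `A_n`.
  have key : ∀ g h : FreeMetabelian n, bar g = bar h → h ∈ derivedCentralizer D →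
      g ∈ derivedCentralizer D := fun g h hgh hh => by
    rw [← inv_mul_cancel_right g h]
    exact mul_mem (commutator_le_derivedCentralizer mul_comm_of_mem_commutator D
      (mul_inv_mem_commutator_of_bar_eq hgh)) hh
  have hle : AddSubgroup.closure S ≤
      Subgroup.toAddSubgroup' ((derivedCentralizer D).map (barHom n)) := by
    rw [AddSubgroup.closure_le]
    intro a ha
    obtain ⟨g, hg, rfl⟩ := hS a ha
    exact ⟨g, hg, rfl⟩
  intro g hg
  obtain ⟨h, hh, hhg⟩ := hle hg
  exact key g h hhg.symm hh

theorem wedgeExtHom_area_mul {n : ℕ} (g h : FreeMetabelian n) :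
    (wedgeExtHom n (g * h)).area
      = (wedgeExtHom n g).area + (wedgeExtHom n h).area + halfWedge (bar g) (bar h) := by
  rw [map_mul, WedgeExt.mul_area, wedgeExtHom_pt, wedgeExtHom_pt]

theorem wedgeExtHom_area_one {n : ℕ} : (wedgeExtHom n (1 : FreeMetabelian n)).area = 0 := by
  rw [map_one]; rfl

theorem wedgeExtHom_area_commutatorElement {n : ℕ} (g h : FreeMetabelian n) :
    (wedgeExtHom n ⁅g, h⁆).area = wedge (bar g) (bar h) :=
  phi_commutator g h (commutatorElement_mem_commutator g h)

/-- Let `N` be the preimage of `L` and `D` a normal subgroup modulo which `N` commutes with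
`M_n'`.  Then the elements of `N'` of area zero lie in `D`: modulo `D` an element of `N'` is
determined by a class in `Λ²(L)`, which is mapped injectively to `Λ²(A_n)`. -/
theorem mem_of_area_eq_zero {n : ℕ} (L : AddSubgroup (A n)) (D : Subgroup (FreeMetabelian n))
    [D.Normal] (hD : D ≤ commutator (FreeMetabelian n))
    (hLD : preimage L ≤ derivedCentralizer D) (k : preimage L)
    (hk : k ∈ commutator (preimage L)) (harea : (wedgeExtHom n (k : FreeMetabelian n)).area = 0) :
    (k : FreeMetabelian n) ∈ D := by
  let p₀ : preimage L →* Multiplicative L :=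
    { toFun g := Multiplicative.ofAdd ⟨bar (g : FreeMetabelian n), g.2⟩
      map_one' := Multiplicative.toAdd.injective (Subtype.ext bar_one)
      map_mul' g h := Multiplicative.toAdd.injective (Subtype.ext (bar_mul _ _)) }
  have hp₀ : ∀ g : preimage L, p₀ g = 1 ↔ (g : FreeMetabelian n) ∈ commutator _ := fun g => by
    rw [← bar_eq_zero_iff, ← toAdd_eq_zero]
    exact Subtype.ext_iff
  let p : preimage L ⧸ D.subgroupOf (preimage L) →* Multiplicative L :=
    QuotientGroup.lift _ p₀ fun g hg => (hp₀ g).2 (hD hg)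
  have hp : Function.Surjective p := by
    intro l
    obtain ⟨g, hg⟩ := bar_surjective n l.toAdd
    refine ⟨QuotientGroup.mk ⟨g, ?_⟩, Multiplicative.toAdd.injective (Subtype.ext hg)⟩
    rw [mem_preimage, hg]
    exact l.toAdd.2
  -- The kernel is `M_n'/D`, and N commutes with `M_n'` modulo `D`.
  have hc : p.ker ≤ Subgroup.center _ := by
    intro x hx
    obtain ⟨s, rfl⟩ := QuotientGroup.mk_surjective x
    rw [Subgroup.mem_center_iff]
    intro y
    obtain ⟨y, rfl⟩ := QuotientGroup.mk_surjective y
    symm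
    rw [← commutatorElement_eq_one_iff_mul_comm]
    apply (QuotientGroup.eq_one_iff (⁅s, y⁆ : preimage L)).2
    exact hLD y.2 _ ((hp₀ s).1 hx)
  obtain ⟨β, hβ⟩ := exists_commutatorPairing p hp hc
  let j : L →ₗ[ℤ] A n := L.subtype.toIntLinearMap
  -- One `ω` must serve both purposes: it determines `y` modulo `D` and maps to the area of `y`.
  -- This holds for commutators and is multiplicative, as the area is additive on elements over 0.
  have key : ∀ y ∈ commutator (preimage L), ∃ ω : ⋀[ℤ]^2 L,
      β (Multiplicative.ofAdd ω) = QuotientGroup.mk y ∧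
      exteriorPower.map 2 j ω = (wedgeExtHom n (y : FreeMetabelian n)).area := by
    have hbar : ∀ y ∈ commutator (preimage L), bar (y : FreeMetabelian n) = 0 := fun y hy =>
      (bar_eq_zero_iff _).2 <| (hp₀ y).1 <| Abelianization.commutator_subset_ker p₀ hy
    intro y hy
    rw [commutator_eq_closure] at hy
    induction hy using Subgroup.closure_induction with
    | mem y hy =>
      obtain ⟨a, b, rfl⟩ := hy
      refine ⟨_, hβ (QuotientGroup.mk a) (QuotientGroup.mk b), ?_⟩
      rw [exteriorPower.map_apply_ιMulti]
      refine Eq.trans ?_ (wedgeExtHom_area_commutatorElement _ _).symm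
      refine congrArg (exteriorPower.ιMulti ℤ 2) (funext fun i => ?_)
      fin_cases i <;> rfl
    | one =>
      refine ⟨0, map_one β, ?_⟩
      rw [map_zero, Subgroup.coe_one, wedgeExtHom_area_one]
    | mul y z hy hz ihy ihz =>
      obtain ⟨ω, h1, h2⟩ := ihy
      obtain ⟨ω', h1', h2'⟩ := ihz
      refine ⟨ω + ω', ?_, ?_⟩
      · rw [ofAdd_add, map_mul, h1, h1']; rfl
      · rw [← commutator_eq_closure] at hy
        rw [map_add, Subgroup.coe_mul, wedgeExtHom_area_mul, hbar y hy, halfWedge_zero_left,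
          add_zero, h2, h2']
    | inv y hy ihy =>
      obtain ⟨ω, h1, h2⟩ := ihy
      refine ⟨-ω, ?_, ?_⟩
      · rw [ofAdd_neg, map_inv, h1]; rfl
      · rw [← commutator_eq_closure] at hy
        have h3 := wedgeExtHom_area_mul (y : FreeMetabelian n) (y : FreeMetabelian n)⁻¹
        rw [mul_inv_cancel, wedgeExtHom_area_one, hbar y hy, halfWedge_zero_left, add_zero] at h3
        rw [map_neg, h2, Subgroup.coe_inv, neg_eq_iff_add_eq_zero, h3]
  obtain ⟨ω, h1, h2⟩ := key k hk
  rw [harea] at h2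
  have hω : ω = 0 := exteriorPower_map_injective 2 j Subtype.val_injective (by rw [h2, map_zero])
  rw [hω, ofAdd_zero, map_one] at h1
  exact (QuotientGroup.eq_one_iff k).1 h1.symm

/-- Elements of `M_n'` with zero chain in `Γ_n / L` and zero area lie in every normal subgroup
modulo which the preimage of `L` commutes with `M_n'`. -/
theorem mem_of_tau_eq_zero_of_area_eq_zero {n : ℕ} (L : AddSubgroup (A n))
    (D : Subgroup (FreeMetabelian n)) [D.Normal] (hD : D ≤ commutator (FreeMetabelian n))
    (hLD : preimage L ≤ derivedCentralizer D) (k : FreeMetabelian n) (hk : bar k = 0)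
    (htau : tau L k = 0) (harea : (wedgeExtHom n k).area = 0) : k ∈ D := by
  have hkL : k ∈ preimage L := by
    rw [mem_preimage, hk]
    exact zero_mem L
  exact mem_of_area_eq_zero L D hD hLD ⟨k, hkL⟩
    (mem_commutator_preimage_of_tau_eq_zero L ⟨k, hkL⟩ htau) harea

/-! ### Chain and area of the two sides of the equation -/

theorem bar_prod_ofFn {n k : ℕ} (x : Fin k → FreeMetabelian n) :
    bar (List.ofFn x).prod = ∑ i, bar (x i) := by
  induction k with
  | zero => simp
  | succ k ih => rw [List.ofFn_succ, List.prod_cons, bar_mul, ih, Fin.sum_univ_succ]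

theorem bar_commutatorElement {n : ℕ} (g h : FreeMetabelian n) : bar ⁅g, h⁆ = 0 :=
  (bar_eq_zero_iff _).2 (commutatorElement_mem_commutator g h)

theorem bar_conj {n : ℕ} (g h : FreeMetabelian n) : bar (g * h * g⁻¹) = bar h := by
  rw [bar_mul, bar_mul, bar_inv]
  abel

/-- Translation by an element of `L` is trivial on `Γ_n/L`, so `τ_L` is a homomorphism on N. -/
theorem tau_mul_of_mem {n : ℕ} {L : AddSubgroup (A n)} {g : FreeMetabelian n} (hg : bar g ∈ L)
    (h : FreeMetabelian n) : tau L (g * h) = tau L g + tau L h := by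
  rw [tau_mul, (QuotientAddGroup.eq_zero_iff _).2 hg, shift_zero]

theorem tau_prod_ofFn {n k : ℕ} {L : AddSubgroup (A n)} (x : Fin k → FreeMetabelian n)
    (hx : ∀ i, bar (x i) ∈ L) : tau L (List.ofFn x).prod = ∑ i, tau L (x i) := by
  induction k with
  | zero => simp [tau_one]
  | succ k ih =>
    rw [List.ofFn_succ, List.prod_cons, tau_mul_of_mem (hx 0), ih _ fun i => hx i.succ,
      Fin.sum_univ_succ]

theorem tau_commutatorElement {n : ℕ} {L : AddSubgroup (A n)} {g h : FreeMetabelian n}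
    (hg : bar g ∈ L) (hh : bar h ∈ L) : tau L ⁅g, h⁆ = 0 := by
  have h1 : ⁅g, h⁆ * (h * g) = g * h := by rw [commutatorElement_def]; group
  have h2 := congrArg (tau L) h1
  rw [tau_mul_of_mem ((bar_commutatorElement g h).symm ▸ zero_mem L), tau_mul_of_mem hg,
    tau_mul_of_mem hh, add_comm (tau L h)] at h2
  exact add_eq_right.1 h2

/-- Here `w` need not lie in N. Compute `τ_L(wc)` twice, as `(wcw⁻¹)w` with first factor in N and as
`w` followed by the translate of `c`, and cancel `τ_L(w)`. -/
theorem tau_conj {n : ℕ} {L : AddSubgroup (A n)} (w : FreeMetabelian n) {c : FreeMetabelian n}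
    (hc : bar c ∈ L) : tau L (w * c * w⁻¹) = shift (QuotientAddGroup.mk (bar w)) (tau L c) := by
  have h2 := congrArg (tau L) (inv_mul_cancel_right (w * c) w)
  rw [tau_mul_of_mem ((bar_conj w c).symm ▸ hc), tau_mul L w c, add_comm] at h2
  exact add_left_cancel h2

theorem area_prod_commutatorElement {n k : ℕ} (x y : Fin k → FreeMetabelian n) :
    (wedgeExtHom n (List.ofFn fun i => ⁅x i, y i⁆).prod).area
      = ∑ i, wedge (bar (x i)) (bar (y i)) := by
  induction k with
  | zero => exact wedgeExtHom_area_one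
  | succ k ih =>
    rw [List.ofFn_succ, List.prod_cons, wedgeExtHom_area_mul, ih, bar_commutatorElement,
      halfWedge_zero_left, add_zero, wedgeExtHom_area_commutatorElement, Fin.sum_univ_succ]

/-- Each factor is `[w, c]c`, which adds the area `w̄ ∧ c̄`; the cocycle terms are those of the
product of the `c_i`, since conjugation does not change the image in `A_n`. -/
theorem area_prod_conj {n k : ℕ} (w c : Fin k → FreeMetabelian n) :
    (wedgeExtHom n (List.ofFn fun i => w i * c i * (w i)⁻¹).prod).area
      = ∑ i, wedge (bar (w i)) (bar (c i)) + (wedgeExtHom n (List.ofFn c).prod).area := by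
  induction k with
  | zero => simp
  | succ k ih =>
    have h1 : (wedgeExtHom n (w 0 * c 0 * (w 0)⁻¹)).area
        = wedge (bar (w 0)) (bar (c 0)) + (wedgeExtHom n (c 0)).area := by
      rw [← inv_mul_cancel_right (w 0 * c 0 * (w 0)⁻¹) (c 0), ← commutatorElement_def,
        wedgeExtHom_area_mul, bar_commutatorElement, halfWedge_zero_left, add_zero,
        wedgeExtHom_area_commutatorElement]
    have h2 : bar (List.ofFn fun i : Fin k => w i.succ * c i.succ * (w i.succ)⁻¹).prod
        = bar (List.ofFn fun i : Fin k => c i.succ).prod := by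
      simp only [bar_prod_ofFn, bar_conj]
    rw [List.ofFn_succ, List.prod_cons, wedgeExtHom_area_mul, ih, h1, bar_conj, h2,
      List.ofFn_succ, List.prod_cons, wedgeExtHom_area_mul, Fin.sum_univ_succ]
    abel

/-! ### Counting labels: (1) implies that the product of coefficients lies in the derived subgroup
-/

/-- The homomorphism `C_1(Γ_n / L) → A_n` that counts the edges by their labels. -/
noncomputable def labelCount {n : ℕ} (H : Type) : Chains n H →+ A n :=
  Finsupp.liftAddHom fun q => zmultiplesHom _ (e q.2)

theorem labelCount_single {n : ℕ} {H : Type} (x : H) (i : Fin n) (k : ℤ) :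
    labelCount H (Finsupp.single (x, i) k) = k • e i := by
  simp [labelCount]

theorem labelCount_shift {n : ℕ} {H : Type} [AddCommGroup H] (h : H) (c : Chains n H) :
    labelCount H (shift h c) = labelCount H c := by
  induction c using Finsupp.induction_linear with
  | zero => rw [map_zero]
  | add c d hc hd => rw [map_add, map_add, map_add, hc, hd]
  | single q k => rw [shift_single, labelCount_single, labelCount_single]

theorem labelCount_proj {n : ℕ} (L : AddSubgroup (A n)) (c : Chains n (A n)) :
    labelCount (A n ⧸ L) (proj L c) = labelCount (A n) c := by
  induction c using Finsupp.induction_linear with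
  | zero => rw [map_zero, map_zero, map_zero]
  | add c d hc hd => rw [map_add, map_add, map_add, hc, hd]
  | single q k => rw [proj_single, labelCount_single, labelCount_single]

theorem labelCount_sigma {n : ℕ} (g : FreeMetabelian n) : labelCount (A n) (sigma g) = bar g := by
  have hmul : ∀ g h : FreeMetabelian n, labelCount (A n) (sigma (g * h))
      = labelCount (A n) (sigma g) + labelCount (A n) (sigma h) := fun g h => by
    rw [sigma_mul, map_add, labelCount_shift]
  induction g using induction_gen with
  | one => rw [sigma_one, map_zero, bar_one]
  | gen i => rw [sigma_gen, labelCount_single, one_smul, bar_gen]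
  | mul g h hg hh => rw [hmul, hg, hh, bar_mul]
  | inv g hg =>
    have h := hmul g g⁻¹
    rw [mul_inv_cancel, sigma_one, map_zero, hg] at h
    rw [bar_inv, eq_neg_iff_add_eq_zero, add_comm, ← h]

theorem labelCount_tau {n : ℕ} (L : AddSubgroup (A n)) (g : FreeMetabelian n) :
    labelCount (A n ⧸ L) (tau L g) = bar g := by
  rw [tau, labelCount_proj, labelCount_sigma]

/-- Translations and projections preserve labels, so counting labels in (1) yields `∑ c̄_i = 0`. -/
theorem prod_mem_commutator_of_coefficientCondition {n g m : ℕ} (c : Fin m → FreeMetabelian n)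
    (u v : Fin g → A n) (w : Fin m → A n) (h : CoefficientCondition c u v w) :
    (List.ofFn c).prod ∈ commutator (FreeMetabelian n) := by
  have h1 := congrArg (labelCount _) h
  simp only [map_sum, labelCount_shift, labelCount_tau, map_zero] at h1
  rw [← bar_eq_zero_iff, bar_prod_ofFn, h1]

/-! ### Correcting arbitrary lifts to a solution -/

section Solutions

variable {n g m : ℕ} (c : Fin m → FreeMetabelian n) (U V : Fin g → FreeMetabelian n)
  (W : Fin m → FreeMetabelian n)

theorem tau_subgroupL_prod_commutatorElement :
    tau (subgroupL c (fun i => bar (U i)) fun i => bar (V i)) (List.ofFn fun i => ⁅U i, V i⁆).prod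
      = 0 := by
  rw [tau_prod_ofFn _ fun i => (bar_commutatorElement (U i) (V i)).symm ▸ zero_mem _]
  exact Finset.sum_eq_zero fun i _ => tau_commutatorElement
    (AddSubgroup.subset_closure (Or.inl (Or.inl ⟨i, rfl⟩)))
    (AddSubgroup.subset_closure (Or.inl (Or.inr ⟨i, rfl⟩)))

theorem tau_subgroupL_prod_conj (u v : Fin g → A n) :
    tau (subgroupL c u v) (List.ofFn fun i => W i * c i * (W i)⁻¹).prod
      = ∑ i, shift (QuotientAddGroup.mk (bar (W i)) : A n ⧸ subgroupL c u v)
          (tau (subgroupL c u v) (c i)) := by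
  have hc : ∀ i, bar (c i) ∈ subgroupL c u v := fun i =>
    AddSubgroup.subset_closure (Or.inr ⟨i, rfl⟩)
  rw [tau_prod_ofFn _ fun i => (bar_conj (W i) (c i)).symm ▸ hc i]
  exact Finset.sum_congr rfl fun i _ => tau_conj _ (hc i)

/-- The elements by which the product of commutators can be multiplied, relative to the product of
conjugates, when the variables are multiplied by elements of `M_n'`. -/
def corrections : Subgroup (FreeMetabelian n) :=
  (⨆ i, derivedCommutators mul_comm_of_mem_commutator (U i)
    ⊔ derivedCommutators mul_comm_of_mem_commutator (V i))
  ⊔ ⨆ i, derivedCommutators mul_comm_of_mem_commutator (c i)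

instance corrections_normal : (corrections c U V).Normal := by
  have h : ∀ x : FreeMetabelian n, (derivedCommutators mul_comm_of_mem_commutator x).Normal :=
    derivedCommutators_normal _
  unfold corrections
  infer_instance

theorem corrections_le_commutator : corrections c U V ≤ commutator (FreeMetabelian n) :=
  sup_le (iSup_le fun _ => sup_le (derivedCommutators_le _ _) (derivedCommutators_le _ _))
    (iSup_le fun _ => derivedCommutators_le _ _)

theorem preimage_subgroupL_le_derivedCentralizer :
    preimage (subgroupL c (fun i => bar (U i)) fun i => bar (V i))
      ≤ derivedCentralizer (corrections c U V) := by
  apply preimage_closure_le_derivedCentralizer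
  rintro a ((⟨i, rfl⟩ | ⟨i, rfl⟩) | ⟨i, rfl⟩)
  · exact ⟨U i, fun s hs => Subgroup.mem_sup_left <| Subgroup.mem_iSup_of_mem i <|
      Subgroup.mem_sup_left ⟨s, hs, rfl⟩, rfl⟩
  · exact ⟨V i, fun s hs => Subgroup.mem_sup_left <| Subgroup.mem_iSup_of_mem i <|
      Subgroup.mem_sup_right ⟨s, hs, rfl⟩, rfl⟩
  · exact ⟨c i, fun s hs => Subgroup.mem_sup_right <| Subgroup.mem_iSup_of_mem i ⟨s, hs, rfl⟩, rfl⟩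

theorem liftsToSolution_of_mem_corrections
    (h : (List.ofFn fun i => ⁅U i, V i⁆).prod⁻¹ * (List.ofFn fun i => W i * c i * (W i)⁻¹).prod
      ∈ corrections c U V) :
    LiftsToSolution c (fun i => bar (U i)) (fun i => bar (V i)) fun i => bar (W i) := by
  have hn : ∀ x : FreeMetabelian n, (derivedCommutators mul_comm_of_mem_commutator x).Normal :=
    derivedCommutators_normal _
  have hbar : ∀ s ∈ commutator (FreeMetabelian n), ∀ x, bar (s * x) = bar x := fun s hs x => by
    rw [bar_mul, (bar_eq_zero_iff s).2 hs, zero_add]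
  -- Write `P⁻¹Q = d₁d₂`. Changing U and V turns `P` into `P d₁`, changing W turns `Q` into `Q
  -- d₂⁻¹`, and these agree.
  obtain ⟨d₁, hd₁, d₂, hd₂, hd⟩ := Subgroup.mem_sup_of_normal_right.1 h
  obtain ⟨x, hx, hxprod⟩ := exists_prod_ofFn_eq_mul _ (fun i => inferInstance)
    (fun i => {z | ∃ s ∈ commutator (FreeMetabelian n), ∃ t ∈ commutator (FreeMetabelian n),
      ⁅s * U i, t * V i⁆ = z}) (fun i => ⁅U i, V i⁆)
    (fun i d hd => exists_commutatorElement_eq_mul mul_comm_of_mem_commutator _ _ _ hd) d₁ hd₁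
  obtain ⟨y, hy, hyprod⟩ := exists_prod_ofFn_eq_mul _ (fun i => inferInstance)
    (fun i => {z | ∃ s ∈ commutator (FreeMetabelian n), (s * W i) * c i * (s * W i)⁻¹ = z})
    (fun i => W i * c i * (W i)⁻¹)
    (fun i d hd => exists_conj_eq_mul mul_comm_of_mem_commutator _ _ _ hd) d₂⁻¹ (inv_mem hd₂)
  choose s hs t ht hst using hx
  choose r hr hry using hy
  refine ⟨fun i => s i * U i, fun i => t i * V i, fun i => r i * W i, fun i => hbar _ (hs i) _,
    fun i => hbar _ (ht i) _, fun i => hbar _ (hr i) _, ?_⟩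
  show (List.ofFn fun i => ⁅s i * U i, t i * V i⁆).prod
    = (List.ofFn fun i => (r i * W i) * c i * (r i * W i)⁻¹).prod
  rw [funext hst, funext hry, hxprod, hyprod, eq_mul_inv_iff_mul_eq, mul_assoc, hd,
    mul_inv_cancel_left]

end Solutions

end FreeMetabelian

/-! ### The lifting criterion -/

open FreeMetabelian

theorem proposition3p1 (n : ℕ) (hn : 2 ≤ n) (g m : ℕ)
    (c : Fin m → FreeMetabelian n)
    (u v : Fin g → FreeMetabelian.A n) (w : Fin m → FreeMetabelian.A n) :
    (FreeMetabelian.CoefficientCondition c u v w →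
      (List.ofFn c).prod ∈ commutator (FreeMetabelian n)) ∧
    (FreeMetabelian.LiftsToSolution c u v w ↔
      FreeMetabelian.CoefficientCondition c u v w ∧
        ∃ hc : (List.ofFn c).prod ∈ commutator (FreeMetabelian n),
          FreeMetabelian.HomologyCondition c hc u v w) := by
  refine ⟨prod_mem_commutator_of_coefficientCondition c u v w, ?_, ?_⟩
  · rintro ⟨U, V, W, hU, hV, hW, hsol⟩
    obtain rfl : (fun i => bar (U i)) = u := funext hU
    obtain rfl : (fun i => bar (V i)) = v := funext hV
    obtain rfl : (fun i => bar (W i)) = w := funext hW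
    have hcoef : CoefficientCondition c (fun i => bar (U i)) (fun i => bar (V i))
        fun i => bar (W i) := by
      rw [CoefficientCondition, ← tau_subgroupL_prod_conj, ← hsol]
      exact tau_subgroupL_prod_commutatorElement c U V
    refine ⟨hcoef, prod_mem_commutator_of_coefficientCondition c _ _ _ hcoef, ?_⟩
    have harea := congrArg (fun x => (wedgeExtHom n x).area) hsol
    exact (area_prod_commutatorElement U V).symm.trans (harea.trans (area_prod_conj W c))
  · rintro ⟨hcoef, hc, hhom⟩
    choose f hf using bar_surjective n
    obtain ⟨U, rfl⟩ : ∃ U : Fin g → FreeMetabelian n, u = fun i => bar (U i) :=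
      ⟨fun i => f (u i), funext fun i => (hf _).symm⟩
    obtain ⟨V, rfl⟩ : ∃ V : Fin g → FreeMetabelian n, v = fun i => bar (V i) :=
      ⟨fun i => f (v i), funext fun i => (hf _).symm⟩
    obtain ⟨W, rfl⟩ : ∃ W : Fin m → FreeMetabelian n, w = fun i => bar (W i) :=
      ⟨fun i => f (w i), funext fun i => (hf _).symm⟩
    apply liftsToSolution_of_mem_corrections
    set P := (List.ofFn fun i => ⁅U i, V i⁆).prod with hP
    set Q := (List.ofFn fun i => W i * c i * (W i)⁻¹).prod with hQ
    have hPbar : bar P = 0 := by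
      rw [hP, bar_prod_ofFn]
      exact Finset.sum_eq_zero fun i _ => bar_commutatorElement _ _
    have hQbar : bar Q = 0 := by
      rw [hQ, bar_prod_ofFn]
      simp only [bar_conj]
      rw [← bar_prod_ofFn, bar_eq_zero_iff]
      exact hc
    -- Chain and area are additive on this product because `P` lies over 0, so those of `P⁻¹Q` are
    -- read off as differences.
    have hPQ : P * (P⁻¹ * Q) = Q := mul_inv_cancel_left P Q
    apply mem_of_tau_eq_zero_of_area_eq_zero _ _ (corrections_le_commutator c U V)
      (preimage_subgroupL_le_derivedCentralizer c U V)
    · rw [bar_mul, bar_inv, hPbar, hQbar, neg_zero, zero_add]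
    · have h := congrArg (tau (subgroupL c (fun i => bar (U i)) fun i => bar (V i))) hPQ
      rw [tau_mul_of_mem (hPbar.symm ▸ zero_mem _), hP, tau_subgroupL_prod_commutatorElement,
        zero_add, hQ, tau_subgroupL_prod_conj] at h
      exact h.trans hcoef
    · have h := congrArg (fun x => (wedgeExtHom n x).area) hPQ
      have hPQarea : (wedgeExtHom n P).area = (wedgeExtHom n Q).area :=
        (area_prod_commutatorElement U V).trans (hhom.trans (area_prod_conj W c).symm)
      simp only [wedgeExtHom_area_mul P, hPbar, halfWedge_zero_left, add_zero, hPQarea] at h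
      exact add_eq_left.1 h
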